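/- Let $1\le k<d$ and $d\ge 3$ be integers. Let $\mathcal G_{k,d}=\{P\in\mathbb R^{d\times d}: P^\top=P,\ P^2=P,\ \operatorname{trace}P=k\}$ be the set of rank-$k$ orthogonal projectors on $\mathbb R^d$, and let $\sigma_{k,d}$ be the probability measure on $\mathcal G_{k,d}$ that is invariant under $P\mapsto UPU^\top$ for all orthogonal $U$ (the measure induced by the Haar measure of the orthogonal group). For nonnegative integers $\ell,t$ put $$\mathrm{Pol}^\ell_t(\mathcal G_{k,d})=\operatorname{span}\{P\mapsto \operatorname{trace}(MP)^s:\ M\in\mathbb R^{d\times d},\ M^\top=M,\ \operatorname{rank}M\le \ell,\ s\le t\}.$$ Points $P_1,\dots,P_n\in\mathcal G_{k,d}$ with weights $\omega_1,\dots,\omega_n\in\mathbb R$ form a cubature for $\mathrm{Pol}^\ell_t(\mathcal G_{k,d})$ if $\sum_{j=1}^n\omega_jf(P_j)=\int_{\mathcal G_{k,d}} f\,d\sigma_{k,d}$ for all $f\in \mathrm{Pol}^\ell_t(\mathcal G_{k,d})$. Define $$A_1=\frac dk,\qquad A_2=\frac{(d-1)d(d+2)}{k(dk+d-2)},\qquad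 B_2=\frac{(d-k)d}{kd(k+1)-2k},$$ $$q_{3,d}=(d-2)(d-1)d(d+2)(d+4),\qquad \alpha_{(1,1,1)}=(d^2+3d-2)k^3-6(d+2)k^2+16k,$$ $$\alpha_{(2,1)}=-6(d+2)k^3+6(d^2+2d+4)k^2-24dk,\qquad \alpha_{(3)}=16k^3-24dk^2+8d^2k,$$ $$C^{(1)}_{3,d}=\frac{4q_{3,d}}{4\alpha_{(1,1,1)}+2\alpha_{(2,1)}+\alpha_{(3)}},\qquad C^{(2)}_{3,d}=\frac{2\alpha_{(2,1)}+3\alpha_{(3)}}{\left(4\alpha_{(1,1,1)}+2\alpha_{(2,1)}+\alpha_{(3)}\right)\frac{k(k+2)}{d(d+2)}}.$$ Let $X=(X_1,\dots,X_d)$ be a random vector in $\mathbb R^d$, let $P_1,\dots,P_n\in\mathcal G_{k,d}$ and $\omega_1,\dots,\omega_n\in\mathbb R$, and let $i,h,\ell\in\{1,\dots,d\}$ be pairwise distinct. (i) If $\{(P_j,\omega_j)\}_{j=1}^n$ is a cubature for $\mathrm{Pol}^2_1(\mathcal G_{k,d})$ and $\mathbb E|X_a|<\infty$ for all $a$, then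 $$\mathbb E X_i=A_1\sum_{j=1}^n\omega_j\,\mathbb E(P_jX)_i.\tag{1}$$ (ii) If $\{(P_j,\omega_j)\}_{j=1}^n$ is a cubature for $\mathrm{Pol}^2_2(\mathcal G_{k,d})$ and $\mathbb E|X_a|^2<\infty$ for all $a$, then (1) holds and $$\mathbb E X_i^2=A_2\sum_{j=1}^n\omega_j\,\mathbb E(P_jX)_i^2-B_2\sum_{j=1}^n\sum_{m=1}^d\omega_j\,\mathbb E(P_jX)_m^2,\tag{2}$$ $$\mathbb E X_iX_\ell=A_2\sum_{j=1}^n\omega_j\,\mathbb E(P_jX)_i(P_jX)_\ell.\tag{3}$$ (iii) If $\{(P_j,\omega_j)\}_{j=1}^n$ is a cubature for $\mathrm{Pol}^2_3(\mathcal G_{k,d})$ and $\mathbb E|X_a|^3<\infty$ for all $a$, then (1), (2), (3) hold and $$\mathbb E X_i^3=C^{(1)}_{3,d}\sum_{j=1}^n\omega_j\,\mathbb E(P_jX)_i^3-C^{(2)}_{3,d}\sum_{j=1}^n\sum_{m=1}^d\omega_j\,\mathbb E(P_jX)_i(P_jX)_m^2,$$ $$\mathbb E X_i^2X_h=C^{(1)}_{3,d}\sum_{j=1}^n\omega_j\,\mathbb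 E(P_jX)_i^2(P_jX)_h-\tfrac13C^{(2)}_{3,d}\sum_{j=1}^n\sum_{m=1}^d\omega_j\,\mathbb E(P_jX)_h(P_jX)_m^2,$$ $$\mathbb E X_iX_hX_\ell=C^{(1)}_{3,d}\sum_{j=1}^n\omega_j\,\mathbb E(P_jX)_i(P_jX)_h(P_jX)_\ell.$$ -/

import Mathlib

open MeasureTheory Matrix

namespace MomentFusion

/-! ### The Grassmannian and its invariant probability measure -/

/-- The Grassmannian: symmetric idempotent real `d × d` matrices of trace `k`, that is, the
orthogonal projectors of rank `k` on `ℝ^d`. -/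
def Grassmannian (k d : ℕ) : Set (Matrix (Fin d) (Fin d) ℝ) :=
  {P | Pᵀ = P ∧ P * P = P ∧ P.trace = (k : ℝ)}

instance (k d : ℕ) : MeasurableSpace (Grassmannian k d) := borel _

instance (k d : ℕ) : BorelSpace (Grassmannian k d) := ⟨rfl⟩

instance (d : ℕ) : MeasurableSpace (Matrix.orthogonalGroup (Fin d) ℝ) := borel _

instance (d : ℕ) : BorelSpace (Matrix.orthogonalGroup (Fin d) ℝ) := ⟨rfl⟩

instance (d : ℕ) : CompactSpace (Matrix.orthogonalGroup (Fin d) ℝ) := by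
  have hc : IsCompact (Set.univ.pi fun _ : Fin d => Set.univ.pi fun _ : Fin d =>
      Set.Icc (-1 : ℝ) 1) :=
    isCompact_univ_pi fun _ => isCompact_univ_pi fun _ => isCompact_Icc
  have hcl : IsClosed (Matrix.orthogonalGroup (Fin d) ℝ : Set (Matrix (Fin d) (Fin d) ℝ)) := by
    have : (Matrix.orthogonalGroup (Fin d) ℝ : Set (Matrix (Fin d) (Fin d) ℝ))
        = {A | A * A.transpose = 1} := by
      ext A
      exact Matrix.mem_orthogonalGroup_iff (Fin d) ℝ
    rw [this]
    exact isClosed_eq (by fun_prop) continuous_const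
  refine isCompact_iff_compactSpace.mp (IsCompact.of_isClosed_subset hc hcl ?_)
  intro A hA i _ j _
  have h := entry_norm_bound_of_unitary (𝕜 := ℝ) hA i j
  rw [Real.norm_eq_abs] at h
  exact abs_le.mp h

/-- The diagonal matrix with `k` ones followed by zeros. -/
def diagProj (k d : ℕ) : Matrix (Fin d) (Fin d) ℝ :=
  Matrix.diagonal fun i => if i.val < k then 1 else 0

/-- The orthogonal conjugate `U D Uᵀ` of the standard projector, as a point of the Grassmannian. -/
def orbitMap {k d : ℕ} (hk : k ≤ d) (U : Matrix.orthogonalGroup (Fin d) ℝ) : Grassmannian k d :=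
  ⟨(U : Matrix (Fin d) (Fin d) ℝ) * diagProj k d * (U : Matrix (Fin d) (Fin d) ℝ)ᵀ, by
    have hU : (U : Matrix (Fin d) (Fin d) ℝ)ᵀ * (U : Matrix (Fin d) (Fin d) ℝ) = 1 :=
      (Matrix.mem_orthogonalGroup_iff' (Fin d) ℝ).mp U.2
    have hDD : diagProj k d * diagProj k d = diagProj k d := by
      simp [diagProj, Matrix.diagonal_mul_diagonal]
    refine ⟨?_, ?_, ?_⟩
    · simp [Matrix.transpose_mul, Matrix.mul_assoc, diagProj]
    · calc _ = (U : Matrix (Fin d) (Fin d) ℝ) * diagProj k d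
            * ((U : Matrix (Fin d) (Fin d) ℝ)ᵀ * (U : Matrix (Fin d) (Fin d) ℝ))
            * diagProj k d * (U : Matrix (Fin d) (Fin d) ℝ)ᵀ := by simp only [Matrix.mul_assoc]
        _ = (U : Matrix (Fin d) (Fin d) ℝ) * (diagProj k d * diagProj k d)
            * (U : Matrix (Fin d) (Fin d) ℝ)ᵀ := by
          rw [hU, Matrix.mul_one]; simp only [Matrix.mul_assoc]
        _ = _ := by rw [hDD]
    · rw [Matrix.trace_mul_comm, ← Matrix.mul_assoc, hU, Matrix.one_mul, diagProj,
        Matrix.trace_diagonal, Finset.sum_boole, Fin.card_filter_val_lt, Nat.min_eq_right hk]⟩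

/-- The orthogonally invariant probability measure on the Grassmannian: the image of the normalized
Haar measure of the orthogonal group. -/
noncomputable def grassmannMeasure {k d : ℕ} (hk : k ≤ d) : Measure (Grassmannian k d) :=
  (Measure.haarMeasure (⊤ : TopologicalSpace.PositiveCompacts
    (Matrix.orthogonalGroup (Fin d) ℝ))).map (orbitMap hk)

theorem continuous_orbitMap {k d : ℕ} (hk : k ≤ d) : Continuous (orbitMap hk) := by
  unfold orbitMap
  fun_prop

instance {k d : ℕ} (hk : k ≤ d) : IsProbabilityMeasure (grassmannMeasure hk) := by
  have : IsProbabilityMeasure (Measure.haarMeasure (⊤ : TopologicalSpace.PositiveCompacts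
      (Matrix.orthogonalGroup (Fin d) ℝ))) := by
    constructor
    have h := Measure.haarMeasure_self (K₀ := (⊤ : TopologicalSpace.PositiveCompacts
      (Matrix.orthogonalGroup (Fin d) ℝ)))
    rwa [TopologicalSpace.PositiveCompacts.coe_top] at h
  exact Measure.isProbabilityMeasure_map (continuous_orbitMap hk).measurable.aemeasurable

/-! ### Polynomial spaces and cubatures -/

/-- `Pol^ℓ_t`: the linear span, inside the functions on the Grassmannian, of the powers
`P ↦ ⟨M, P⟩ ^ s = trace (M P) ^ s` with `M` symmetric of rank at most `ℓ` and `s ≤ t`. -/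
def Pol (k d ℓ t : ℕ) : Submodule ℝ (Grassmannian k d → ℝ) :=
  Submodule.span ℝ {f | ∃ M : Matrix (Fin d) (Fin d) ℝ, ∃ s : ℕ,
    Mᵀ = M ∧ M.rank ≤ ℓ ∧ s ≤ t ∧ f = fun P => (M * P.1).trace ^ s}

/-- The points `P j` with the real weights `ω j` form a cubature for `Pol^ℓ_t`. -/
def IsCubature {k d n : ℕ} (hk : k ≤ d) (ℓ t : ℕ)
    (P : Fin n → Grassmannian k d) (ω : Fin n → ℝ) : Prop :=
  ∀ f ∈ Pol k d ℓ t, ∑ j, ω j * f (P j) = ∫ Q, f Q ∂(grassmannMeasure hk)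

/-! ### The constants -/

/-- `q_{3,d}` -/
def q3 (d : ℝ) : ℝ := (d - 2) * (d - 1) * d * (d + 2) * (d + 4)

/-- `α_{(1,1,1)}` -/
def α111 (k d : ℝ) : ℝ := (d ^ 2 + 3 * d - 2) * k ^ 3 - 6 * (d + 2) * k ^ 2 + 16 * k

/-- `α_{(2,1)}` -/
def α21 (k d : ℝ) : ℝ :=
  -6 * (d + 2) * k ^ 3 + 6 * (d ^ 2 + 2 * d + 4) * k ^ 2 - 24 * d * k

/-- `α_{(3)}` -/
def α3 (k d : ℝ) : ℝ := 16 * k ^ 3 - 24 * d * k ^ 2 + 8 * d ^ 2 * k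

/-- `A_1` -/
noncomputable def A1 (k d : ℝ) : ℝ := d / k

/-- `A_2` -/
noncomputable def A2 (k d : ℝ) : ℝ := (d - 1) * d * (d + 2) / (k * (d * k + d - 2))

/-- `B_2` -/
noncomputable def B2 (k d : ℝ) : ℝ := (d - k) * d / (k * d * (k + 1) - 2 * k)

/-- `C^{(1)}_{3,d}` -/
noncomputable def C1 (k d : ℝ) : ℝ := 4 * q3 d / (4 * α111 k d + 2 * α21 k d + α3 k d)

/-- `C^{(2)}_{3,d}`. The numerator has `3 * α3`, since
`trace (E ^ 3) = (⟨x, y⟩ ^ 3 + 3 * ⟨x, y⟩ * ‖x‖ ^ 2 * ‖y‖ ^ 2) / 4` for `E = (x yᵀ + y xᵀ) / 2`. -/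
noncomputable def C2 (k d : ℝ) : ℝ :=
  (2 * α21 k d + 3 * α3 k d) /
    ((4 * α111 k d + 2 * α21 k d + α3 k d) * (k * (k + 2) / (d * (d + 2))))

end MomentFusion

/-! The claims follow from pointwise identities in a fixed vector `x`, integrated afterwards against
the law of `X`. The symmetric matrix `(x yᵀ + y xᵀ) / 2` has rank at most 2 and pairs with `P` to
`⟨P x, y⟩`. Hence a cubature for `Pol^2_t` reproduces the averages of `⟨P x, y⟩ ^ s`, `s ≤ t`, and
polarization in `y` turns these powers into products of coordinates of `P x`.

The averages come from orthogonal invariance. Reflections bring `(x, y)` to `(r u, a u + b w)` with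
`u`, `w` orthonormal (`exists_average_eq`), so only moments of one diagonal and one off-diagonal
entry of `P` matter. Invariance, `P * P = P` and `trace P = k` yield a recurrence for the diagonal
moments (`average_diag`, `average_diag_sq`, `average_diag_cube`) and express the off-diagonal ones
through them (`average_offdiag`).

The resulting formulas contain the wanted monomial in the coordinates of `x` and an excess with a
factor `|x|²`. Since `|P x|² = ⟨P x, x⟩`, exactness in one degree less expresses this excess by the
cubature too; this produces the terms with `B2` and `C2`. -/

namespace MomentFusion

/-! ### Averages of continuous functions on the Grassmannian -/

/-- The bilinear form `⟨P x, y⟩` of a projector, as a continuous function of `P`. -/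
def bilin {k d : ℕ} (x y : Fin d → ℝ) : C(Grassmannian k d, ℝ) where
  toFun Q := (Q.1 *ᵥ x) ⬝ᵥ y
  continuous_toFun := by fun_prop

/-- Conjugation of a projector by an orthogonal matrix. -/
def conjMap {k d : ℕ} (U : Matrix.orthogonalGroup (Fin d) ℝ) :
    C(Grassmannian k d, Grassmannian k d) where
  toFun Q := ⟨(U : Matrix (Fin d) (Fin d) ℝ) * Q.1 * (U : Matrix (Fin d) (Fin d) ℝ)ᵀ, by
    have hU : (U : Matrix (Fin d) (Fin d) ℝ)ᵀ * (U : Matrix (Fin d) (Fin d) ℝ) = 1 :=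
      (Matrix.mem_orthogonalGroup_iff' (Fin d) ℝ).mp U.2
    obtain ⟨h1, h2, h3⟩ := Q.2
    refine ⟨by simp [Matrix.transpose_mul, Matrix.mul_assoc, h1], ?_, ?_⟩
    · calc _ = (U : Matrix (Fin d) (Fin d) ℝ) * Q.1
            * ((U : Matrix (Fin d) (Fin d) ℝ)ᵀ * (U : Matrix (Fin d) (Fin d) ℝ))
            * Q.1 * (U : Matrix (Fin d) (Fin d) ℝ)ᵀ := by simp only [Matrix.mul_assoc]
        _ = (U : Matrix (Fin d) (Fin d) ℝ) * (Q.1 * Q.1)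
            * (U : Matrix (Fin d) (Fin d) ℝ)ᵀ := by
          rw [hU, Matrix.mul_one]; simp only [Matrix.mul_assoc]
        _ = _ := by rw [h2]
    · rw [Matrix.trace_mul_comm, ← Matrix.mul_assoc, hU, Matrix.one_mul, h3]⟩
  continuous_toFun := by fun_prop

theorem integrable_grassmannMeasure {k d : ℕ} (hk : k ≤ d) (f : C(Grassmannian k d, ℝ)) :
    Integrable f (grassmannMeasure hk) := by
  have hsm : AEStronglyMeasurable f ((Measure.haarMeasure (⊤ : TopologicalSpace.PositiveCompacts
      (Matrix.orthogonalGroup (Fin d) ℝ))).map (orbitMap hk)) :=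
    f.continuous.measurable.stronglyMeasurable.aestronglyMeasurable
  refine (integrable_map_measure hsm (continuous_orbitMap hk).measurable.aemeasurable).mpr ?_
  exact (f.continuous.comp (continuous_orbitMap hk)).integrable_of_hasCompactSupport
    (HasCompactSupport.of_compactSpace _)

/-- The average of a continuous function over the Grassmannian. -/
noncomputable def average {k d : ℕ} (hk : k ≤ d) : C(Grassmannian k d, ℝ) →ₗ[ℝ] ℝ where
  toFun f := ∫ Q, f Q ∂(grassmannMeasure hk)
  map_add' f g :=
    integral_add (integrable_grassmannMeasure hk f) (integrable_grassmannMeasure hk g)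
  map_smul' c _ := integral_const_mul c _

theorem average_one {k d : ℕ} (hk : k ≤ d) : average hk 1 = 1 := by
  simp [average]

/-- Conjugation by `U` is left translation by `U` on the orthogonal group, which preserves Haar
measure. -/
theorem average_conj {k d : ℕ} (hk : k ≤ d) (U : Matrix.orthogonalGroup (Fin d) ℝ)
    (f : C(Grassmannian k d, ℝ)) : average hk (f.comp (conjMap U)) = average hk f := by
  have key : ∀ g : C(Grassmannian k d, ℝ), average hk g =
      ∫ V, g (orbitMap hk V) ∂(Measure.haarMeasure (⊤ : TopologicalSpace.PositiveCompacts
        (Matrix.orthogonalGroup (Fin d) ℝ))) := fun g =>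
    integral_map (continuous_orbitMap hk).measurable.aemeasurable
      g.continuous.measurable.stronglyMeasurable.aestronglyMeasurable
  rw [key, key, ← integral_mul_left_eq_self (fun V => f (orbitMap hk V)) U]
  congr 1
  ext V
  simp only [ContinuousMap.comp_apply]
  congr 1
  apply Subtype.ext
  simp [conjMap, orbitMap, Matrix.mul_assoc, Matrix.transpose_mul]

theorem bilin_apply {k d : ℕ} (x y : Fin d → ℝ) (Q : Grassmannian k d) :
    bilin x y Q = (Q.1 *ᵥ x) ⬝ᵥ y := rfl

/-! ### Algebra of `⟨P x, y⟩` and the identities from `P * P = P` and `trace P = k` -/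

section bilin

variable {k d : ℕ} (x y z : Fin d → ℝ) (c : ℝ)

theorem bilin_add_left : (bilin (x + y) z : C(Grassmannian k d, ℝ)) = bilin x z + bilin y z := by
  ext Q; simp [bilin_apply, Matrix.mulVec_add]

theorem bilin_add_right : (bilin x (y + z) : C(Grassmannian k d, ℝ)) = bilin x y + bilin x z := by
  ext Q; simp [bilin_apply]

theorem bilin_smul_left : (bilin (c • x) y : C(Grassmannian k d, ℝ)) = c • bilin x y := by
  ext Q; simp [bilin_apply, Matrix.mulVec_smul]

theorem bilin_smul_right : (bilin x (c • y) : C(Grassmannian k d, ℝ)) = c • bilin x y := by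
  ext Q; simp [bilin_apply]

theorem bilin_comm : (bilin x y : C(Grassmannian k d, ℝ)) = bilin y x := by
  ext Q
  rw [bilin_apply, bilin_apply, dotProduct_comm, Matrix.dotProduct_mulVec,
    ← Matrix.mulVec_transpose, Q.2.1]

theorem bilin_single_right (i : Fin d) (Q : Grassmannian k d) :
    bilin x (Pi.single i 1) Q = (Q.1 *ᵥ x) i := by
  simp [bilin_apply]

theorem sum_mulVec_sq (Q : Grassmannian k d) :
    ∑ m, (Q.1 *ᵥ x) m ^ 2 = bilin x x Q := by
  have h : (Q.1 *ᵥ x) ⬝ᵥ (Q.1 *ᵥ x) = (Q.1 *ᵥ x) ⬝ᵥ x := by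
    rw [Matrix.dotProduct_mulVec, ← Matrix.mulVec_transpose, Q.2.1, Matrix.mulVec_mulVec, Q.2.2.1]
  rw [bilin_apply, ← h]
  simp [dotProduct, sq]

theorem sum_bilin_single_sq :
    ∑ m, (bilin x (Pi.single m 1) : C(Grassmannian k d, ℝ)) ^ 2 = bilin x x := by
  ext Q
  simp only [ContinuousMap.sum_apply, ContinuousMap.pow_apply, bilin_single_right]
  exact sum_mulVec_sq x Q

theorem sum_bilin_single_single :
    ∑ m : Fin d, (bilin (Pi.single m 1) (Pi.single m 1) : C(Grassmannian k d, ℝ))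
      = (k : ℝ) • 1 := by
  ext Q
  simp only [ContinuousMap.sum_apply, bilin_single_right]
  simpa [Matrix.trace] using Q.2.2.2

end bilin

/-! ### Householder reflections -/

/-- The reflection along `v` (the identity if `v = 0`). -/
noncomputable def householder {d : ℕ} (v x : Fin d → ℝ) : Fin d → ℝ :=
  x - (2 * (v ⬝ᵥ x) / (v ⬝ᵥ v)) • v

/-- The matrix of the reflection along `v`. -/
noncomputable def householderMatrix {d : ℕ} (v : Fin d → ℝ) : Matrix (Fin d) (Fin d) ℝ :=
  1 - (2 / (v ⬝ᵥ v)) • vecMulVec v v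

theorem householderMatrix_mulVec {d : ℕ} (v x : Fin d → ℝ) :
    householderMatrix v *ᵥ x = householder v x := by
  ext i
  simp only [householderMatrix, householder, sub_mulVec, one_mulVec, smul_mulVec, vecMulVec_mulVec,
    Pi.sub_apply, Pi.smul_apply, smul_eq_mul, MulOpposite.smul_eq_mul_unop, MulOpposite.unop_op]
  ring

theorem householderMatrix_transpose {d : ℕ} (v : Fin d → ℝ) :
    (householderMatrix v)ᵀ = householderMatrix v := by
  simp [householderMatrix, transpose_vecMulVec]

theorem householder_householder {d : ℕ} (v x : Fin d → ℝ) :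
    householder v (householder v x) = x := by
  by_cases hv : v ⬝ᵥ v = 0
  · simp [householder, hv]
  · ext i
    simp only [householder, dotProduct_sub, dotProduct_smul, Pi.sub_apply, Pi.smul_apply,
      smul_eq_mul]
    field_simp
    ring

theorem householderMatrix_mem {d : ℕ} (v : Fin d → ℝ) :
    householderMatrix v ∈ Matrix.orthogonalGroup (Fin d) ℝ := by
  rw [Matrix.mem_orthogonalGroup_iff]
  rw [householderMatrix_transpose]
  apply Matrix.ext_of_mulVec_single
  intro i
  rw [← Matrix.mulVec_mulVec, householderMatrix_mulVec, householderMatrix_mulVec,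
    householder_householder, one_mulVec]

theorem householder_dotProduct {d : ℕ} (v x y : Fin d → ℝ) :
    householder v x ⬝ᵥ householder v y = x ⬝ᵥ y := by
  by_cases hv : v ⬝ᵥ v = 0
  · simp [householder, hv]
  · simp only [householder, dotProduct_sub, dotProduct_smul, sub_dotProduct, smul_dotProduct,
      smul_eq_mul, dotProduct_comm x v]
    field_simp
    ring

theorem householder_of_dotProduct_eq_zero {d : ℕ} {v x : Fin d → ℝ} (h : v ⬝ᵥ x = 0) :
    householder v x = x := by
  simp [householder, h]

/-- The bisecting hyperplane of two vectors of equal length passes through the origin, and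
reflection in it swaps them. -/
theorem householder_sub {d : ℕ} {x y : Fin d → ℝ} (h : x ⬝ᵥ x = y ⬝ᵥ y) :
    householder (x - y) x = y := by
  by_cases hv : (x - y) ⬝ᵥ (x - y) = 0
  · rw [dotProduct_self_eq_zero, sub_eq_zero] at hv
    simp [householder, hv]
  · have h2 : 2 * ((x - y) ⬝ᵥ x) / ((x - y) ⬝ᵥ (x - y)) = 1 := by
      rw [div_eq_one_iff_eq hv]
      simp only [dotProduct_sub, sub_dotProduct, dotProduct_comm y x]
      linarith
    rw [householder, h2, one_smul, sub_sub_cancel]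

theorem bilin_comp_conjMap_householder {k d : ℕ} (v x y : Fin d → ℝ) :
    (bilin x y : C(Grassmannian k d, ℝ)).comp
      (conjMap ⟨householderMatrix v, householderMatrix_mem v⟩)
      = bilin (householder v x) (householder v y) := by
  ext Q
  simp only [ContinuousMap.comp_apply, bilin_apply, conjMap, ContinuousMap.coe_mk,
    householderMatrix_transpose]
  rw [← Matrix.mulVec_mulVec, ← Matrix.mulVec_mulVec, householderMatrix_mulVec v x,
    ← householderMatrix_mulVec v y, Matrix.dotProduct_mulVec, ← Matrix.mulVec_transpose,
    householderMatrix_transpose]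

/-- The only form in which invariance is used below: the two exponents cover pure powers and the
mixed moments of a diagonal and an off-diagonal entry. -/
theorem average_householder {k d : ℕ} (hk : k ≤ d) (v x y : Fin d → ℝ) (a b : ℕ) :
    average hk (bilin (householder v x) (householder v x) ^ a
      * bilin (householder v x) (householder v y) ^ b)
      = average hk (bilin x x ^ a * bilin x y ^ b) := by
  rw [← average_conj hk ⟨householderMatrix v, householderMatrix_mem v⟩ (bilin x x ^ a * _)]
  simp only [← bilin_comp_conjMap_householder]
  rfl

/-! ### Moments of the bilinear form -/

section moments

variable {k d : ℕ} (hk : k ≤ d)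

theorem average_bilin_self_pow {u : Fin d → ℝ} (hu : u ⬝ᵥ u = 1) (x : Fin d → ℝ) (t : ℕ) :
    average hk (bilin x x ^ t) = (x ⬝ᵥ x) ^ t * average hk (bilin u u ^ t) := by
  have hx : 0 ≤ x ⬝ᵥ x := by
    simpa using dotProduct_star_self_nonneg x
  have hr : √(x ⬝ᵥ x) * √(x ⬝ᵥ x) = x ⬝ᵥ x := Real.mul_self_sqrt hx
  have h : x ⬝ᵥ x = (√(x ⬝ᵥ x) • u) ⬝ᵥ (√(x ⬝ᵥ x) • u) := by
    rw [dotProduct_smul, smul_dotProduct, hu, smul_eq_mul, smul_eq_mul, mul_one, hr]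
  have key := average_householder hk (x - √(x ⬝ᵥ x) • u) x 0 t 0
  rw [householder_sub h] at key
  simp only [pow_zero, mul_one, bilin_smul_left, bilin_smul_right, smul_smul, hr] at key
  rw [← key, smul_pow, map_smul, smul_eq_mul]

/-- Two reflections suffice: the first takes `x` to `r u`; the second fixes `u` and takes the part
of the image of `y` orthogonal to `u` to `b w`. The dot products are preserved, hence readable from
the normal form. -/
theorem exists_average_eq {u w : Fin d → ℝ} (hu : u ⬝ᵥ u = 1) (hw : w ⬝ᵥ w = 1)
    (huw : u ⬝ᵥ w = 0) (x y : Fin d → ℝ) :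
    ∃ r a b : ℝ, x ⬝ᵥ x = r ^ 2 ∧ x ⬝ᵥ y = r * a ∧ y ⬝ᵥ y = a ^ 2 + b ^ 2 ∧
      ∀ t : ℕ, average hk (bilin x y ^ t)
        = r ^ t * average hk ((a • bilin u u + b • bilin u w) ^ t) := by
  have hself : ∀ z : Fin d → ℝ, √(z ⬝ᵥ z) * √(z ⬝ᵥ z) = z ⬝ᵥ z := fun z =>
    Real.mul_self_sqrt (by simpa using dotProduct_star_self_nonneg z)
  have hnorm : ∀ z v : Fin d → ℝ, v ⬝ᵥ v = 1 →
      z ⬝ᵥ z = (√(z ⬝ᵥ z) • v) ⬝ᵥ (√(z ⬝ᵥ z) • v) := fun z v hv => by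
    rw [dotProduct_smul, smul_dotProduct, hv, smul_eq_mul, smul_eq_mul, mul_one, hself]
  set r := √(x ⬝ᵥ x) with hr
  set v₁ := x - r • u with hv₁
  set y' := householder v₁ y with hy'
  set a := u ⬝ᵥ y' with ha
  set z := y' - a • u with hz
  set b := √(z ⬝ᵥ z) with hb
  set v₂ := z - b • w with hv₂
  have hx1 : householder v₁ x = r • u := householder_sub (hnorm x u hu)
  have huz : u ⬝ᵥ z = 0 := by
    rw [hz, dotProduct_sub, dotProduct_smul, hu, ← ha]; simp
  have hz2 : householder v₂ z = b • w := householder_sub (hnorm z w hw)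
  have hv₂u : v₂ ⬝ᵥ u = 0 := by
    rw [hv₂, dotProduct_comm, dotProduct_sub, huz, dotProduct_smul, huw]; simp
  have hu2 : householder v₂ u = u := householder_of_dotProduct_eq_zero hv₂u
  have hru2 : householder v₂ (r • u) = r • u :=
    householder_of_dotProduct_eq_zero (by rw [dotProduct_smul, hv₂u, smul_zero])
  have hy2 : householder v₂ y' = a • u + b • w := by
    have : householder v₂ y' = a • householder v₂ u + householder v₂ z := by
      have hyz : y' = a • u + z := by rw [hz]; abel
      conv_lhs => rw [hyz]
      ext i
      simp only [householder, dotProduct_add, dotProduct_smul, Pi.sub_apply, Pi.add_apply,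
        Pi.smul_apply, smul_eq_mul]
      ring
    rw [this, hu2, hz2]
  have hdot : ∀ p q : Fin d → ℝ,
      householder v₂ (householder v₁ p) ⬝ᵥ householder v₂ (householder v₁ q) = p ⬝ᵥ q :=
    fun p q => by rw [householder_dotProduct, householder_dotProduct]
  have hwu : w ⬝ᵥ u = 0 := by rw [dotProduct_comm, huw]
  refine ⟨r, a, b, ?_, ?_, ?_, fun t => ?_⟩
  · rw [sq]; exact (hself x).symm
  · rw [← hdot x y, hx1, hru2, ← hy', hy2]
    simp [hu, huw, mul_comm]
  · rw [← hdot y y, ← hy', hy2]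
    simp [hu, hw, huw, hwu]
    ring
  · have h1 := average_householder hk v₁ x y 0 t
    have h2 := average_householder hk v₂ (householder v₁ x) (householder v₁ y) 0 t
    rw [hx1, hru2, ← hy', hy2] at h2
    rw [hx1] at h1
    simp only [pow_zero, one_mul] at h1 h2
    rw [← h1, ← h2, bilin_smul_left, bilin_add_right, bilin_smul_right, bilin_smul_right, smul_pow,
      map_smul, smul_eq_mul]

/-- Reflection along `w` fixes `u` and negates `w`. -/
theorem average_bilin_odd {u w : Fin d → ℝ} (hw : w ⬝ᵥ w = 1) (huw : u ⬝ᵥ w = 0) (s : ℕ) {t : ℕ}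
    (ht : Odd t) : average hk (bilin u u ^ s * bilin u w ^ t) = 0 := by
  have h := average_householder hk w u w s t
  have h1 : householder w u = u :=
    householder_of_dotProduct_eq_zero (by rw [dotProduct_comm, huw])
  have h2 : householder w w = (-1 : ℝ) • w := by
    ext i
    simp only [householder, hw, Pi.sub_apply, Pi.smul_apply, smul_eq_mul]
    ring
  rw [h1, h2, bilin_smul_right, smul_pow, ht.neg_one_pow, mul_smul_comm, map_smul,
    smul_eq_mul] at h
  linarith

/-- Reflection along `w - w'` swaps `w` and `w'` and fixes `u`. -/
theorem average_bilin_congr {u w w' : Fin d → ℝ} (hw : w ⬝ᵥ w = w' ⬝ᵥ w') (huw : u ⬝ᵥ w = 0)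
    (huw' : u ⬝ᵥ w' = 0) (s t : ℕ) :
    average hk (bilin u u ^ s * bilin u w ^ t) = average hk (bilin u u ^ s * bilin u w' ^ t) := by
  have h := average_householder hk (w - w') u w s t
  rw [householder_sub hw, householder_of_dotProduct_eq_zero
    (by rw [dotProduct_comm, dotProduct_sub, huw, huw', sub_zero])] at h
  exact h.symm

theorem bilin_add_smul_self (u w : Fin d → ℝ) (s : ℝ) :
    (bilin (u + s • w) (u + s • w) : C(Grassmannian k d, ℝ))
      = bilin u u + (2 * s) • bilin u w + (s ^ 2) • bilin w w := by
  rw [bilin_add_left, bilin_add_right, bilin_add_right, bilin_smul_left, bilin_smul_left,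
    bilin_smul_right, bilin_smul_right, bilin_comm w u]
  ext Q
  simp only [ContinuousMap.add_apply, ContinuousMap.smul_apply, smul_eq_mul]
  ring

section orthonormal

variable {u w : Fin d → ℝ} (hu : u ⬝ᵥ u = 1) (hw : w ⬝ᵥ w = 1) (huw : u ⬝ᵥ w = 0)
include hu hw huw

/-- Since `|u + s w|² = 1 + s²`, this is an identity of polynomials in `s`; comparing coefficients
of `s ^ 2` gives the next two relations. -/
theorem average_bilin_add_smul_pow (s : ℝ) (t : ℕ) :
    average hk ((bilin u u + (2 * s) • bilin u w + (s ^ 2) • bilin w w) ^ t)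
      = (1 + s ^ 2) ^ t * average hk (bilin u u ^ t) := by
  rw [← bilin_add_smul_self, average_bilin_self_pow hk hu]
  congr 2
  have hwu : w ⬝ᵥ u = 0 := by rw [dotProduct_comm, huw]
  simp [hu, hw, huw, hwu]
  ring

theorem average_sq_relation :
    average hk (bilin u u * bilin w w) + 2 * average hk (bilin u w ^ 2)
      = average hk (bilin u u ^ 2) := by
  have h1 := average_bilin_add_smul_pow hk hu hw huw 1 2
  have h2 := average_bilin_add_smul_pow hk hu hw huw (-1) 2
  have hc := average_bilin_self_pow hk hu w 2
  rw [hw] at hc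
  -- Adding the values at `s = 1` and `s = -1` removes the odd powers of `s`.
  have key : (bilin u u + (2 * 1 : ℝ) • bilin u w + ((1 : ℝ) ^ 2) • bilin w w) ^ 2
      + (bilin u u + (2 * (-1) : ℝ) • bilin u w + ((-1 : ℝ) ^ 2) • bilin w w) ^ 2
      = (2 : ℝ) • bilin u u ^ 2 + (2 : ℝ) • bilin w w ^ 2
        + (4 : ℝ) • (bilin u u * bilin w w : C(Grassmannian k d, ℝ))
        + (8 : ℝ) • bilin u w ^ 2 := by
    ext Q
    simp
    ring
  have := congrArg (average hk) key
  simp only [map_add, map_smul, smul_eq_mul] at this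
  rw [h1, h2] at this
  linarith

theorem average_cube_relation :
    average hk (bilin u u ^ 2 * bilin w w) + 4 * average hk (bilin u u * bilin u w ^ 2)
      = average hk (bilin u u ^ 3) := by
  have h1 := average_bilin_add_smul_pow hk hu hw huw 1 3
  have h2 := average_bilin_add_smul_pow hk hu hw huw (-1) 3
  have h3 := average_bilin_add_smul_pow hk hu hw huw 2 3
  have h4 := average_bilin_add_smul_pow hk hu hw huw (-2) 3
  have hc := average_bilin_self_pow hk hu w 3
  rw [hw] at hc
  -- The even part is sampled at `s = ±1` and `s = ±2`. The weight 16 cancels the coefficient of `s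
  -- ^ 4`; the pure cubes are corrected by 96 and 30, and 24 times the coefficient of `s ^ 2`
  -- remains.
  have key : (16 : ℝ) • ((bilin u u + (2 * 1 : ℝ) • bilin u w + ((1 : ℝ) ^ 2) • bilin w w) ^ 3
      + (bilin u u + (2 * (-1) : ℝ) • bilin u w + ((-1 : ℝ) ^ 2) • bilin w w) ^ 3)
      + (96 : ℝ) • bilin w w ^ 3
      = ((bilin u u + (2 * 2 : ℝ) • bilin u w + ((2 : ℝ) ^ 2) • bilin w w) ^ 3
      + (bilin u u + (2 * (-2) : ℝ) • bilin u w + ((-2 : ℝ) ^ 2) • bilin w w) ^ 3)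
      + (30 : ℝ) • bilin u u ^ 3 + (72 : ℝ) • (bilin u u ^ 2 * bilin w w : C(Grassmannian k d, ℝ))
      + (288 : ℝ) • (bilin u u * bilin u w ^ 2) := by
    ext Q
    simp
    ring
  have := congrArg (average hk) key
  simp only [map_add, map_smul, smul_eq_mul] at this
  rw [h1, h2, h3, h4] at this
  linarith

end orthonormal

/-! ### Recurrence for the moments of matrix entries -/

theorem single_dotProduct_single_self (i : Fin d) :
    (Pi.single i 1 : Fin d → ℝ) ⬝ᵥ Pi.single i 1 = 1 := by simp

theorem single_dotProduct_single_of_ne {i j : Fin d} (h : i ≠ j) :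
    (Pi.single i 1 : Fin d → ℝ) ⬝ᵥ Pi.single j 1 = 0 := by simp [h]

variable (i : Fin d)

theorem sum_erase_bilin_single_sq :
    ∑ m ∈ Finset.univ.erase i,
        (bilin (Pi.single i 1) (Pi.single m 1) : C(Grassmannian k d, ℝ)) ^ 2
      = bilin (Pi.single i 1) (Pi.single i 1) - bilin (Pi.single i 1) (Pi.single i 1) ^ 2 := by
  rw [eq_sub_iff_add_eq, Finset.sum_erase_add _ _ (Finset.mem_univ i), sum_bilin_single_sq]

theorem sum_erase_bilin_single_single :
    ∑ m ∈ Finset.univ.erase i,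
        (bilin (Pi.single m 1) (Pi.single m 1) : C(Grassmannian k d, ℝ))
      = (k : ℝ) • 1 - bilin (Pi.single i 1) (Pi.single i 1) := by
  rw [eq_sub_iff_add_eq, Finset.sum_erase_add _ _ (Finset.mem_univ i), sum_bilin_single_single]

theorem card_erase_real : ((Finset.univ.erase i).card : ℝ) = d - 1 := by
  rw [Finset.card_erase_of_mem (Finset.mem_univ i), Finset.card_univ, Fintype.card_fin,
    Nat.cast_sub (Nat.one_le_of_lt i.2), Nat.cast_one]

theorem average_diag : d * average hk (bilin (Pi.single i 1) (Pi.single i 1)) = k := by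
  have h := congrArg (average hk) (sum_bilin_single_single (k := k) (d := d))
  have h' : ∀ m ∈ Finset.univ, average hk (bilin (Pi.single m 1) (Pi.single m 1))
      = average hk (bilin (Pi.single i 1) (Pi.single i 1)) := fun m _ => by
    simpa using average_bilin_self_pow hk (single_dotProduct_single_self i) (Pi.single m 1) 1
  rw [map_sum, Finset.sum_congr rfl h', map_smul, average_one] at h
  simpa using h

/-- The mixed moments with one off-diagonal square, from `P * P = P`. -/
theorem average_offdiag {j : Fin d} (hij : i ≠ j) (s : ℕ) :
    (d - 1) * average hk
        (bilin (Pi.single i 1) (Pi.single i 1) ^ s * bilin (Pi.single i 1) (Pi.single j 1) ^ 2)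
      = average hk (bilin (Pi.single i 1) (Pi.single i 1) ^ (s + 1))
        - average hk (bilin (Pi.single i 1) (Pi.single i 1) ^ (s + 2)) := by
  have h' : ∀ m ∈ Finset.univ.erase i, average hk
      (bilin (Pi.single i 1) (Pi.single i 1) ^ s * bilin (Pi.single i 1) (Pi.single m 1) ^ 2)
      = average hk
      (bilin (Pi.single i 1) (Pi.single i 1) ^ s * bilin (Pi.single i 1) (Pi.single j 1) ^ 2) :=
    fun m hm => average_bilin_congr hk (by simp)
      (single_dotProduct_single_of_ne (Finset.ne_of_mem_erase hm).symm)
      (single_dotProduct_single_of_ne hij) s 2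
  rw [← map_sub, ← card_erase_real i, ← nsmul_eq_mul, ← Finset.sum_const,
    ← Finset.sum_congr rfl h', ← map_sum, ← Finset.mul_sum, sum_erase_bilin_single_sq]
  congr 1
  ring

/-- Sum `average_sq_relation` over `m ≠ i`: the trace turns the diagonal terms into `k - P_ii`, and
idempotence turns the squares into `P_ii - P_ii²`. -/
theorem average_diag_sq :
    (d + 2) * average hk (bilin (Pi.single i 1) (Pi.single i 1) ^ 2)
      = (k + 2) * average hk (bilin (Pi.single i 1) (Pi.single i 1)) := by
  have h := Finset.sum_congr rfl fun m (hm : m ∈ Finset.univ.erase i) =>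
    average_sq_relation hk (single_dotProduct_single_self i) (single_dotProduct_single_self m)
      (single_dotProduct_single_of_ne (Finset.ne_of_mem_erase hm).symm)
  rw [Finset.sum_add_distrib, ← Finset.mul_sum, ← map_sum, ← map_sum, ← Finset.mul_sum,
    sum_erase_bilin_single_sq, sum_erase_bilin_single_single, Finset.sum_const, nsmul_eq_mul,
    card_erase_real, mul_sub, ← sq, mul_smul_comm, mul_one] at h
  simp only [map_sub, map_smul, smul_eq_mul] at h
  linarith

theorem average_diag_cube :
    (d + 4) * average hk (bilin (Pi.single i 1) (Pi.single i 1) ^ 3)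
      = (k + 4) * average hk (bilin (Pi.single i 1) (Pi.single i 1) ^ 2) := by
  have h := Finset.sum_congr rfl fun m (hm : m ∈ Finset.univ.erase i) =>
    average_cube_relation hk (single_dotProduct_single_self i) (single_dotProduct_single_self m)
      (single_dotProduct_single_of_ne (Finset.ne_of_mem_erase hm).symm)
  rw [Finset.sum_add_distrib, ← Finset.mul_sum, ← map_sum, ← map_sum, ← Finset.mul_sum,
    ← Finset.mul_sum, sum_erase_bilin_single_sq, sum_erase_bilin_single_single, Finset.sum_const,
    nsmul_eq_mul, card_erase_real, mul_sub, mul_sub, ← sq, mul_smul_comm, mul_one, ← pow_succ,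
    ← pow_succ'] at h
  simp only [map_sub, map_smul, smul_eq_mul] at h
  norm_num at h
  linarith

end moments

/-! ### Closed formulas for the first three moments of `⟨P x, y⟩` -/

theorem average_bilin {k d : ℕ} (hd : 3 ≤ d) (hk : k ≤ d) (x y : Fin d → ℝ) :
    average hk (bilin x y) = k / d * (x ⬝ᵥ y) := by
  have hij : (⟨0, by omega⟩ : Fin d) ≠ ⟨1, by omega⟩ := by simp
  obtain ⟨r, a, b, hxx, hxy, hyy, h⟩ := exists_average_eq hk
    (single_dotProduct_single_self _) (single_dotProduct_single_self _)
    (single_dotProduct_single_of_ne hij) x y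
  have h1 := average_bilin_odd hk (single_dotProduct_single_self _)
    (single_dotProduct_single_of_ne hij) 0 odd_one
  have h2 := average_diag hk (⟨0, by omega⟩ : Fin d)
  have hd0 : (d : ℝ) ≠ 0 := by positivity
  specialize h 1
  simp only [pow_one, pow_zero, one_mul, map_add, map_smul, smul_eq_mul] at h h1
  rw [h, hxy, h1]
  field_simp
  linear_combination r * a * h2

theorem average_bilin_sq {k d : ℕ} (hd : 3 ≤ d) (hk : k ≤ d) (x y : Fin d → ℝ) :
    (d - 1) * d * (d + 2) * average hk (bilin x y ^ 2)
      = k * (d * k + d - 2) * (x ⬝ᵥ y) ^ 2 + k * (d - k) * (x ⬝ᵥ x) * (y ⬝ᵥ y) := by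
  have hij : (⟨0, by omega⟩ : Fin d) ≠ ⟨1, by omega⟩ := by simp
  obtain ⟨r, a, b, hxx, hxy, hyy, h⟩ := exists_average_eq hk
    (single_dotProduct_single_self _) (single_dotProduct_single_self _)
    (single_dotProduct_single_of_ne hij) x y
  have h1 := average_bilin_odd hk (single_dotProduct_single_self _)
    (single_dotProduct_single_of_ne hij) 1 odd_one
  have h2 := average_diag hk (⟨0, by omega⟩ : Fin d)
  have h3 := average_diag_sq hk (⟨0, by omega⟩ : Fin d)
  have h4 := average_offdiag hk _ hij 0
  rw [h 2, hxx, hxy, hyy]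
  -- `p` is the diagonal entry and `q` the off-diagonal one.
  generalize bilin (Pi.single _ 1) (Pi.single _ 1) = p at *
  generalize bilin (Pi.single _ 1) (Pi.single _ 1) = q at *
  have e : (a • p + b • q) ^ 2 = a ^ 2 • p ^ 2 + (2 * a * b) • (p ^ 1 * q ^ 1) + b ^ 2 • q ^ 2 := by
    ext Q; simp; ring
  rw [e]
  simp only [map_add, map_smul, smul_eq_mul, h1]
  simp only [pow_zero, one_mul, zero_add, pow_one] at h4
  generalize average hk p = m1 at *
  generalize average hk (p ^ 2) = m2 at *
  generalize average hk (q ^ 2) = n2 at *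
  linear_combination r ^ 2 * (a ^ 2 * (d - 1) * (d * h3 + (k + 2) * h2)
    + b ^ 2 * (d * (d + 2) * h4 + (d + 2) * h2 - d * h3 - (k + 2) * h2))

theorem average_bilin_cube {k d : ℕ} (hd : 3 ≤ d) (hk : k ≤ d) (x y : Fin d → ℝ) :
    (d - 1) * d * (d + 2) * (d + 4) * average hk (bilin x y ^ 3)
      = k * ((d + 2) * k ^ 2 + 3 * d * k + 2 * (d - 4)) * (x ⬝ᵥ y) ^ 3
        + 3 * k * (d - k) * (k + 2) * (x ⬝ᵥ y) * (x ⬝ᵥ x) * (y ⬝ᵥ y) := by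
  have hij : (⟨0, by omega⟩ : Fin d) ≠ ⟨1, by omega⟩ := by simp
  obtain ⟨r, a, b, hxx, hxy, hyy, h⟩ := exists_average_eq hk
    (single_dotProduct_single_self _) (single_dotProduct_single_self _)
    (single_dotProduct_single_of_ne hij) x y
  have h1 := average_bilin_odd hk (single_dotProduct_single_self _)
    (single_dotProduct_single_of_ne hij) 2 odd_one
  have h1' := average_bilin_odd hk (single_dotProduct_single_self _)
    (single_dotProduct_single_of_ne hij) 0 (show Odd 3 by decide)
  have h2 := average_diag hk (⟨0, by omega⟩ : Fin d)
  have h3 := average_diag_sq hk (⟨0, by omega⟩ : Fin d)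
  have h4 := average_diag_cube hk (⟨0, by omega⟩ : Fin d)
  have h5 := average_offdiag hk _ hij 1
  rw [h 3, hxx, hxy, hyy]
  generalize bilin (Pi.single _ 1) (Pi.single _ 1) = p at *
  generalize bilin (Pi.single _ 1) (Pi.single _ 1) = q at *
  have e : (a • p + b • q) ^ 3 = a ^ 3 • p ^ 3 + (3 * a ^ 2 * b) • (p ^ 2 * q ^ 1)
      + (3 * a * b ^ 2) • (p ^ 1 * q ^ 2) + b ^ 3 • (p ^ 0 * q ^ 3) := by
    ext Q; simp; ring
  rw [e]
  simp only [map_add, map_smul, smul_eq_mul, h1, h1']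
  norm_num at h5
  simp only [pow_one]
  generalize average hk p = m1 at *
  generalize average hk (p ^ 2) = m2 at *
  generalize average hk (p ^ 3) = m3 at *
  generalize average hk (p * q ^ 2) = n at *
  have h3' : d * (d + 2) * m2 = k * (k + 2) := by
    linear_combination d * h3 + (k + 2) * h2
  have h4' : d * (d + 2) * (d + 4) * m3 = k * (k + 2) * (k + 4) := by
    linear_combination d * (d + 2) * h4 + (k + 4) * h3'
  linear_combination r ^ 3 * (a ^ 3 * (d - 1) * h4'
    + 3 * a * b ^ 2 * (d * (d + 2) * (d + 4) * h5 + (d + 4) * h3' - h4'))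

/-! ### Reconstruction of vectors from a cubature -/

theorem bilin_pow_mem_Pol {k d s t : ℕ} (hst : s ≤ t) (x y : Fin d → ℝ) :
    (fun Q => bilin x y Q ^ s) ∈ Pol k d 2 t := by
  refine Submodule.subset_span
    ⟨(1 / 2 : ℝ) • vecMulVec x y + (1 / 2 : ℝ) • vecMulVec y x, s, ?_, ?_, hst, ?_⟩
  · simp [transpose_vecMulVec, add_comm]
  · have h : (1 / 2 : ℝ) • vecMulVec x y + (1 / 2 : ℝ) • vecMulVec y x
        = (Matrix.of ![x, y])ᵀ * Matrix.of ![(1 / 2 : ℝ) • y, (1 / 2 : ℝ) • x] := by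
      ext a b
      simp [Matrix.mul_apply, vecMulVec_apply, Fin.sum_univ_two]
      ring
    rw [h]
    exact (rank_mul_le_left _ _).trans (rank_le_width _)
  · funext Q
    have h : ∀ a b : Fin d → ℝ, (vecMulVec a b * Q.1).trace = bilin a b Q := fun a b => by
      rw [vecMulVec_mul, trace_vecMulVec, ← mulVec_transpose, Q.2.1, dotProduct_comm,
        ← bilin_apply, bilin_comm]
    congr 1
    rw [Matrix.add_mul, trace_add, smul_mul, smul_mul, trace_smul, trace_smul, h, h, bilin_comm y x,
      smul_eq_mul]
    ring

/-- The weighted sum of the values of a function at the points `P j`. -/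
def cubatureSum {k d n : ℕ} (P : Fin n → Grassmannian k d) (ω : Fin n → ℝ) :
    C(Grassmannian k d, ℝ) →ₗ[ℝ] ℝ where
  toFun f := ∑ j, ω j * f (P j)
  map_add' f g := by simp [mul_add, Finset.sum_add_distrib]
  map_smul' c f := by simp [Finset.mul_sum, mul_left_comm]

theorem cubatureSum_apply {k d n : ℕ} (P : Fin n → Grassmannian k d) (ω : Fin n → ℝ)
    (f : C(Grassmannian k d, ℝ)) : cubatureSum P ω f = ∑ j, ω j * f (P j) := rfl

section reconstruction

variable {d k n : ℕ} {P : Fin n → Grassmannian k d} {ω : Fin n → ℝ}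

theorem IsCubature.mono {hk : k ≤ d} {s t : ℕ} (hst : s ≤ t) (h : IsCubature hk 2 t P ω) :
    IsCubature hk 2 s P ω := fun f hf => h f <| Submodule.span_mono
  (by rintro f ⟨M, r, h1, h2, h3, h4⟩; exact ⟨M, r, h1, h2, h3.trans hst, h4⟩) hf

theorem IsCubature.sum_bilin_pow {hk : k ≤ d} {s : ℕ} (h : IsCubature hk 2 s P ω)
    (x y : Fin d → ℝ) :
    cubatureSum P ω (bilin x y ^ s) = average hk (bilin x y ^ s) :=
  h _ (bilin_pow_mem_Pol le_rfl x y)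

theorem IsCubature.sum_bilin (hd : 3 ≤ d) {hk : k ≤ d} (h : IsCubature hk 2 1 P ω)
    (x y : Fin d → ℝ) : cubatureSum P ω (bilin x y) = k / d * (x ⬝ᵥ y) := by
  rw [← average_bilin hd hk, ← pow_one (bilin x y), h.sum_bilin_pow]

/-- Polarization `4ab = (a + b)² - (a - b)²`; the common argument `x` keeps `a ± b` of the form `⟨P
x, ·⟩`. -/
theorem IsCubature.sum_bilin_mul (hd : 3 ≤ d) {hk : k ≤ d} (h : IsCubature hk 2 2 P ω)
    (x y z : Fin d → ℝ) :
    (d - 1) * d * (d + 2) * cubatureSum P ω (bilin x y * bilin x z)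
      = k * (d * k + d - 2) * ((x ⬝ᵥ y) * (x ⬝ᵥ z)) + k * (d - k) * (x ⬝ᵥ x) * (y ⬝ᵥ z) := by
  have key : (4 : ℝ) • (bilin x y * bilin x z) + bilin x (y + (-1 : ℝ) • z) ^ 2
      = (bilin x (y + z) ^ 2 : C(Grassmannian k d, ℝ)) := by
    ext Q
    simp only [bilin_add_right, bilin_smul_right, ContinuousMap.add_apply, ContinuousMap.mul_apply,
      ContinuousMap.pow_apply, ContinuousMap.smul_apply, smul_eq_mul]
    ring
  have h0 := congrArg (cubatureSum P ω) key
  rw [map_add, map_smul, smul_eq_mul, h.sum_bilin_pow, h.sum_bilin_pow] at h0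
  have h1 := average_bilin_sq hd hk x (y + z)
  have h2 := average_bilin_sq hd hk x (y + (-1 : ℝ) • z)
  simp only [dotProduct_add, add_dotProduct, dotProduct_smul, smul_dotProduct, smul_eq_mul,
    dotProduct_comm z y] at h1 h2
  linear_combination (1 / 4) * ((d - 1) * d * (d + 2) * h0 + h1 - h2)

theorem IsCubature.sum_bilin_mul_mul (hd : 3 ≤ d) {hk : k ≤ d} (h : IsCubature hk 2 3 P ω)
    (x y z v : Fin d → ℝ) :
    (d - 1) * d * (d + 2) * (d + 4) * cubatureSum P ω (bilin x y * bilin x z * bilin x v)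
      = k * ((d + 2) * k ^ 2 + 3 * d * k + 2 * (d - 4)) * ((x ⬝ᵥ y) * (x ⬝ᵥ z) * (x ⬝ᵥ v))
        + k * (d - k) * (k + 2) * (x ⬝ᵥ x) *
          ((x ⬝ᵥ y) * (z ⬝ᵥ v) + (x ⬝ᵥ z) * (y ⬝ᵥ v) + (x ⬝ᵥ v) * (y ⬝ᵥ z)) := by
  -- Cubic polarization: `24abc` is `(a + b + c)³` minus the three cubes with one sign flipped.
  have key : (24 : ℝ) • (bilin x y * bilin x z * bilin x v) + bilin x (y + z + (-1 : ℝ) • v) ^ 3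
      + bilin x (y + (-1 : ℝ) • z + v) ^ 3 + bilin x ((-1 : ℝ) • y + z + v) ^ 3
      = (bilin x (y + z + v) ^ 3 : C(Grassmannian k d, ℝ)) := by
    ext Q
    simp only [bilin_add_right, bilin_smul_right, ContinuousMap.add_apply, ContinuousMap.mul_apply,
      ContinuousMap.pow_apply, ContinuousMap.smul_apply, smul_eq_mul]
    ring
  have h0 := congrArg (cubatureSum P ω) key
  rw [map_add, map_add, map_add, map_smul, smul_eq_mul, h.sum_bilin_pow, h.sum_bilin_pow,
    h.sum_bilin_pow, h.sum_bilin_pow] at h0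
  have h1 := average_bilin_cube hd hk x (y + z + v)
  have h2 := average_bilin_cube hd hk x (y + z + (-1 : ℝ) • v)
  have h3 := average_bilin_cube hd hk x (y + (-1 : ℝ) • z + v)
  have h4 := average_bilin_cube hd hk x ((-1 : ℝ) • y + z + v)
  simp only [dotProduct_add, add_dotProduct, dotProduct_smul, smul_dotProduct, smul_eq_mul,
    dotProduct_comm z y, dotProduct_comm v y, dotProduct_comm v z] at h1 h2 h3 h4
  linear_combination (1 / 24) * ((d - 1) * d * (d + 2) * (d + 4) * h0 + h1 - h2 - h3 - h4)

theorem cubatureSum_bilin_single (x : Fin d → ℝ) (i : Fin d) :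
    cubatureSum P ω (bilin x (Pi.single i 1)) = ∑ j, ω j * ((P j).1 *ᵥ x) i := by
  simp only [cubatureSum_apply, bilin_single_right]

theorem cubatureSum_bilin_self (x : Fin d → ℝ) :
    cubatureSum P ω (bilin x x) = ∑ j, ∑ m, ω j * ((P j).1 *ᵥ x) m ^ 2 := by
  simp only [cubatureSum_apply, ← Finset.mul_sum, sum_mulVec_sq]

theorem cubatureSum_bilin_single_mul_self (x : Fin d → ℝ) (i : Fin d) :
    cubatureSum P ω (bilin x (Pi.single i 1) * bilin x x)
      = ∑ j, ∑ m, ω j * (((P j).1 *ᵥ x) i * ((P j).1 *ᵥ x) m ^ 2) := by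
  simp only [cubatureSum_apply, ← Finset.mul_sum, sum_mulVec_sq, ContinuousMap.mul_apply,
    bilin_single_right]

/-! ### Pointwise recovery of monomials in the coordinates of `x` -/

theorem eq_A1_mul_sum (hd : 3 ≤ d) (hk : 1 ≤ k) {hkd : k ≤ d} (h : IsCubature hkd 2 1 P ω)
    (x : Fin d → ℝ) (i : Fin d) : x i = A1 k d * ∑ j, ω j * ((P j).1 *ᵥ x) i := by
  have hd0 : (d : ℝ) ≠ 0 := by positivity
  have hk0 : (k : ℝ) ≠ 0 := by positivity
  rw [← cubatureSum_bilin_single, h.sum_bilin hd, A1, dotProduct_single_one]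
  field_simp

theorem A2_denom_pos (hd : 3 ≤ d) (hk : 1 ≤ k) : (0 : ℝ) < k * (d * k + d - 2) := by
  have hd' : (3 : ℝ) ≤ d := by exact_mod_cast hd
  have hk' : (1 : ℝ) ≤ k := by exact_mod_cast hk
  have : (0 : ℝ) ≤ d * k := by positivity
  exact mul_pos (by linarith) (by linarith)

/-- Degree two exactness leaves an excess `δ |x|²`, removed by reading `|x|²` from degree one
exactness. -/
theorem mul_eq_A2_mul_sum_sub (hd : 3 ≤ d) (hk : 1 ≤ k) {hkd : k ≤ d}
    (h : IsCubature hkd 2 2 P ω) (x : Fin d → ℝ) (i l : Fin d) :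
    x i * x l = A2 k d * (∑ j, ω j * (((P j).1 *ᵥ x) i * ((P j).1 *ᵥ x) l))
      - (if l = i then 1 else 0) * B2 k d * ∑ j, ∑ m, ω j * ((P j).1 *ᵥ x) m ^ 2 := by
  have hd0 : (d : ℝ) ≠ 0 := by positivity
  have hD : (d * k + d - 2 : ℝ) ≠ 0 := (pos_of_mul_pos_right (A2_denom_pos hd hk)
    (Nat.cast_nonneg k)).ne'
  have hk0 : (k : ℝ) ≠ 0 := by positivity
  have h1 := (h.mono one_le_two).sum_bilin hd x x
  have h2 := h.sum_bilin_mul hd x (Pi.single i 1) (Pi.single l 1)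
  simp only [cubatureSum_apply, ContinuousMap.mul_apply, bilin_single_right,
    dotProduct_single_one, Pi.single_apply] at h2
  rw [← cubatureSum_bilin_self, h1, A2, B2,
    show (k : ℝ) * d * (k + 1) - 2 * k = k * (d * k + d - 2) by ring]
  rw [eq_comm]
  have hd1 : (d - 1 : ℝ) * d * (d + 2) ≠ 0 := by
    have hd' : (3 : ℝ) ≤ d := by exact_mod_cast hd
    exact mul_ne_zero (mul_ne_zero (by linarith) hd0) (by positivity)
  generalize ∑ j, ω j * (((P j).1 *ᵥ x) i * ((P j).1 *ᵥ x) l) = S at *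
  generalize (if l = i then (1 : ℝ) else 0) = δ at *
  generalize x ⬝ᵥ x = N at *
  generalize hE : (d * k + d - 2 : ℝ) = E at *
  field_simp
  linear_combination h2

/-- Exposes a factor `d - 2` that cancels against `q3`, and the leading coefficient of
`average_bilin_cube`. -/
theorem C1_denom_eq (k d : ℝ) : 4 * α111 k d + 2 * α21 k d + α3 k d
    = 4 * k * (d - 2) * ((d + 2) * k ^ 2 + 3 * d * k + 2 * (d - 4)) := by
  unfold α111 α21 α3; ring

theorem C2_num_eq (k d : ℝ) : 2 * α21 k d + 3 * α3 k d
    = 12 * k * (d - 2) * (d - k) * (k + 2) := by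
  unfold α21 α3; ring

theorem C1_factor_pos (hd : 3 ≤ d) (hk : 1 ≤ k) :
    (0 : ℝ) < (d + 2) * k ^ 2 + 3 * d * k + 2 * (d - 4) := by
  have hd' : (3 : ℝ) ≤ d := by exact_mod_cast hd
  have hk' : (1 : ℝ) ≤ k := by exact_mod_cast hk
  nlinarith [mul_nonneg (sub_nonneg.2 hd') (sub_nonneg.2 hk'), sq_nonneg ((k : ℝ)),
    mul_nonneg (Nat.cast_nonneg (α := ℝ) d) (sq_nonneg (k : ℝ))]

theorem mul_mul_eq_C1_mul_sum_sub (hd : 3 ≤ d) (hk : 1 ≤ k) {hkd : k ≤ d}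
    (h : IsCubature hkd 2 3 P ω) (x : Fin d → ℝ) (i l m : Fin d) :
    x i * x l * x m
      = C1 k d * (∑ j, ω j * (((P j).1 *ᵥ x) i * ((P j).1 *ᵥ x) l * ((P j).1 *ᵥ x) m))
        - C2 k d * (1 / 3) * ((if m = l then 1 else 0) *
              (∑ j, ∑ a, ω j * (((P j).1 *ᵥ x) i * ((P j).1 *ᵥ x) a ^ 2))
            + (if m = i then 1 else 0) *
              (∑ j, ∑ a, ω j * (((P j).1 *ᵥ x) l * ((P j).1 *ᵥ x) a ^ 2))
            + (if l = i then 1 else 0) *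
              (∑ j, ∑ a, ω j * (((P j).1 *ᵥ x) m * ((P j).1 *ᵥ x) a ^ 2))) := by
  have hd' : (3 : ℝ) ≤ d := by exact_mod_cast hd
  have hd0 : (d : ℝ) ≠ 0 := by positivity
  have hk0 : (k : ℝ) ≠ 0 := by positivity
  have hd1 : (d - 1 : ℝ) ≠ 0 := by linarith
  have hd2 : (d - 2 : ℝ) ≠ 0 := by linarith
  have hd3 : (d + 2 : ℝ) ≠ 0 := by positivity
  have hk2 : (k + 2 : ℝ) ≠ 0 := by positivity
  have hF := (C1_factor_pos hd hk).ne'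
  -- Degree two exactness with second form `⟨P x, x⟩`: the coefficients add up to `k (d k + d - 2) +
  -- k (d - k) = (d - 1) k (k + 2)`, whence the factor in the denominator of `C2`.
  have hs : ∀ a : Fin d, cubatureSum P ω (bilin x (Pi.single a 1) * bilin x x)
      = k * (k + 2) / (d * (d + 2)) * (x a * (x ⬝ᵥ x)) := fun a => by
    have h2 := (h.mono (by norm_num : 2 ≤ 3)).sum_bilin_mul hd x (Pi.single a 1) x
    simp only [single_one_dotProduct, dotProduct_single_one] at h2
    rw [div_mul_eq_mul_div, eq_div_iff (by positivity)]
    apply mul_left_cancel₀ hd1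
    linear_combination h2
  have h3 := h.sum_bilin_mul_mul hd x (Pi.single i 1) (Pi.single l 1) (Pi.single m 1)
  simp only [cubatureSum_apply, ContinuousMap.mul_apply, bilin_single_right,
    dotProduct_single_one, Pi.single_apply] at h3
  simp only [← cubatureSum_bilin_single_mul_self, hs]
  rw [C1, C2, C1_denom_eq, C2_num_eq, q3, eq_comm]
  generalize ∑ j, ω j * (((P j).1 *ᵥ x) i * ((P j).1 *ᵥ x) l * ((P j).1 *ᵥ x) m) = S at *
  generalize (if l = i then (1 : ℝ) else 0) = δ₁ at *
  generalize (if m = i then (1 : ℝ) else 0) = δ₂ at *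
  generalize (if m = l then (1 : ℝ) else 0) = δ₃ at *
  generalize x ⬝ᵥ x = N at *
  generalize ((d + 2) * k ^ 2 + 3 * d * k + 2 * (d - 4) : ℝ) = E at *
  field_simp
  linear_combination 12 * h3

end reconstruction

/-! ### Integration against the law of a random vector -/

section integrals

variable {Ω : Type*} [MeasurableSpace Ω] {μ : Measure Ω}

theorem integral_eq_mul_sum {ι : Type*} [Fintype ι] {g : Ω → ℝ} {A : ℝ} {ω : ι → ℝ}
    {F : ι → Ω → ℝ} (hg : ∀ w, g w = A * ∑ j, ω j * F j w) (hF : ∀ j, Integrable (F j) μ) :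
    ∫ w, g w ∂μ = A * ∑ j, ω j * ∫ w, F j w ∂μ := by
  simp only [hg]
  rw [integral_const_mul, integral_finsetSum _ fun j _ => (hF j).const_mul (ω j)]
  simp only [integral_const_mul]

theorem integral_eq_mul_sum_sub {ι κ : Type*} [Fintype ι] [Fintype κ] {g : Ω → ℝ} {A B : ℝ}
    {ω : ι → ℝ} {F : ι → Ω → ℝ} {G : ι → κ → Ω → ℝ}
    (hg : ∀ w, g w = A * (∑ j, ω j * F j w) - B * ∑ j, ∑ m, ω j * G j m w)
    (hF : ∀ j, Integrable (F j) μ) (hG : ∀ j m, Integrable (G j m) μ) :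
    ∫ w, g w ∂μ
      = A * (∑ j, ω j * ∫ w, F j w ∂μ) - B * ∑ j, ∑ m, ω j * ∫ w, G j m w ∂μ := by
  have hF' : Integrable (fun w => ∑ j, ω j * F j w) μ :=
    integrable_finsetSum _ fun j _ => (hF j).const_mul _
  have hG'' : ∀ j, Integrable (fun w => ∑ m, ω j * G j m w) μ := fun j =>
    integrable_finsetSum _ fun m _ => (hG j m).const_mul _
  have hG' : Integrable (fun w => ∑ j, ∑ m, ω j * G j m w) μ :=
    integrable_finsetSum _ fun j _ => hG'' j
  simp only [hg]
  rw [integral_sub (hF'.const_mul A) (hG'.const_mul B), integral_const_mul, integral_const_mul,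
    integral_finsetSum _ fun j _ => (hF j).const_mul (ω j),
    integral_finsetSum _ fun j _ => hG'' j]
  simp only [integral_finsetSum _ fun m _ => (hG _ m).const_mul _, integral_const_mul]

theorem memLp_mulVec {d : ℕ} {p : ENNReal} {X : Ω → Fin d → ℝ}
    (hX : ∀ a, MemLp (fun w => X w a) p μ) (M : Matrix (Fin d) (Fin d) ℝ) (i : Fin d) :
    MemLp (fun w => (M *ᵥ X w) i) p μ := by
  simp only [mulVec, dotProduct]
  exact memLp_finsetSum _ fun a _ => (hX a).const_mul (M i a)

/-- The product is dominated by `|f|³ + |g|³ + |h|³`. -/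
theorem integrable_mul_mul {f g h : Ω → ℝ} (hf : MemLp f 3 μ) (hg : MemLp g 3 μ)
    (hh : MemLp h 3 μ) : Integrable (fun w => f w * g w * h w) μ := by
  have hp : ∀ {u : Ω → ℝ}, MemLp u 3 μ → Integrable (fun w => ‖u w‖ ^ 3) μ := fun hu => by
    simpa using hu.integrable_norm_pow (p := 3) (by norm_num)
  refine (((hp hf).add (hp hg)).add (hp hh)).mono'
    ((hf.1.mul hg.1).mul hh.1) (Filter.Eventually.of_forall fun w => ?_)
  rw [norm_mul, norm_mul]
  simp only [Pi.add_apply]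
  have amgm : ∀ a b c : ℝ, 0 ≤ a → 0 ≤ b → 0 ≤ c → a * b * c ≤ a ^ 3 + b ^ 3 + c ^ 3 := by
    intro a b c ha hb hc
    -- `a³ + b³ + c³ - 3abc` is half of `(a + b + c)((a - b)² + (b - c)² + (c - a)²)`.
    nlinarith [mul_nonneg (add_nonneg (add_nonneg ha hb) hc)
      (add_nonneg (add_nonneg (sq_nonneg (a - b)) (sq_nonneg (b - c))) (sq_nonneg (c - a))),
      mul_nonneg (mul_nonneg ha hb) hc]
  exact amgm _ _ _ (norm_nonneg _) (norm_nonneg _) (norm_nonneg _)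

variable {d k n : ℕ} (hd : 3 ≤ d) (hk : 1 ≤ k) {hkd : k ≤ d} {X : Ω → Fin d → ℝ}
  {P : Fin n → Grassmannian k d} {ω : Fin n → ℝ}
include hd hk

theorem integral_coord (h : IsCubature hkd 2 1 P ω) (hX : ∀ a, MemLp (fun w => X w a) 1 μ)
    (i : Fin d) :
    ∫ w, X w i ∂μ = A1 k d * ∑ j, ω j * ∫ w, ((P j).1 *ᵥ X w) i ∂μ :=
  integral_eq_mul_sum (fun w => eq_A1_mul_sum hd hk h (X w) i)
    fun j => memLp_one_iff_integrable.1 (memLp_mulVec hX (P j).1 i)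

theorem integral_coord_sq (h : IsCubature hkd 2 2 P ω) (hX : ∀ a, MemLp (fun w => X w a) 2 μ)
    (i : Fin d) :
    ∫ w, X w i ^ 2 ∂μ
      = A2 k d * (∑ j, ω j * ∫ w, ((P j).1 *ᵥ X w) i ^ 2 ∂μ)
        - B2 k d * ∑ j, ∑ m, ω j * ∫ w, ((P j).1 *ᵥ X w) m ^ 2 ∂μ :=
  integral_eq_mul_sum_sub
    (fun w => by simpa [sq] using mul_eq_A2_mul_sum_sub hd hk h (X w) i i)
    (fun j => (memLp_mulVec hX (P j).1 i).integrable_sq)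
    fun j m => (memLp_mulVec hX (P j).1 m).integrable_sq

theorem integral_coord_mul (h : IsCubature hkd 2 2 P ω) (hX : ∀ a, MemLp (fun w => X w a) 2 μ)
    {i l : Fin d} (hil : i ≠ l) :
    ∫ w, X w i * X w l ∂μ
      = A2 k d * ∑ j, ω j * ∫ w, ((P j).1 *ᵥ X w) i * ((P j).1 *ᵥ X w) l ∂μ :=
  integral_eq_mul_sum
    (fun w => by simpa [hil.symm] using mul_eq_A2_mul_sum_sub hd hk h (X w) i l)
    fun j => (memLp_mulVec hX (P j).1 i).integrable_mul (memLp_mulVec hX (P j).1 l)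

theorem integral_coord_cube (h : IsCubature hkd 2 3 P ω) (hX : ∀ a, MemLp (fun w => X w a) 3 μ)
    (i : Fin d) :
    ∫ w, X w i ^ 3 ∂μ
      = C1 k d * (∑ j, ω j * ∫ w, ((P j).1 *ᵥ X w) i ^ 3 ∂μ)
        - C2 k d * ∑ j, ∑ m,
            ω j * ∫ w, ((P j).1 *ᵥ X w) i * ((P j).1 *ᵥ X w) m ^ 2 ∂μ := by
  have hP := fun j => memLp_mulVec hX (P j).1
  refine integral_eq_mul_sum_sub (fun w => ?_) (fun j => ?_) fun j m => ?_
  -- All three Kronecker terms coincide and absorb the factor `1 / 3`.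
  · have := mul_mul_eq_C1_mul_sum_sub hd hk h (X w) i i i
    simp only [if_true, one_mul, ← pow_three'] at this
    linear_combination this
  · simpa only [pow_three'] using integrable_mul_mul (hP j i) (hP j i) (hP j i)
  · simpa only [sq, ← mul_assoc] using integrable_mul_mul (hP j i) (hP j m) (hP j m)

theorem integral_coord_sq_mul (h : IsCubature hkd 2 3 P ω)
    (hX : ∀ a, MemLp (fun w => X w a) 3 μ) {i l : Fin d} (hil : i ≠ l) :
    ∫ w, X w i ^ 2 * X w l ∂μ
      = C1 k d * (∑ j, ω j * ∫ w, ((P j).1 *ᵥ X w) i ^ 2 * ((P j).1 *ᵥ X w) l ∂μ)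
        - 1 / 3 * C2 k d * ∑ j, ∑ m,
            ω j * ∫ w, ((P j).1 *ᵥ X w) l * ((P j).1 *ᵥ X w) m ^ 2 ∂μ := by
  have hP := fun j => memLp_mulVec hX (P j).1
  refine integral_eq_mul_sum_sub (fun w => ?_) (fun j => ?_) fun j m => ?_
  -- Only the Kronecker term of the repeated index survives, so `1 / 3` remains.
  · have := mul_mul_eq_C1_mul_sum_sub hd hk h (X w) i i l
    simp only [if_true, one_mul, hil.symm, if_false, zero_mul, zero_add, ← sq] at this
    linear_combination this
  · simpa only [sq] using integrable_mul_mul (hP j i) (hP j i) (hP j l)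
  · simpa only [sq, ← mul_assoc] using integrable_mul_mul (hP j l) (hP j m) (hP j m)

theorem integral_coord_mul_mul (h : IsCubature hkd 2 3 P ω)
    (hX : ∀ a, MemLp (fun w => X w a) 3 μ) {i l m : Fin d} (hil : i ≠ l) (hlm : l ≠ m)
    (hmi : m ≠ i) :
    ∫ w, X w i * X w l * X w m ∂μ
      = C1 k d * ∑ j, ω j *
          ∫ w, ((P j).1 *ᵥ X w) i * ((P j).1 *ᵥ X w) l * ((P j).1 *ᵥ X w) m ∂μ := by
  have hP := fun j => memLp_mulVec hX (P j).1
  refine integral_eq_mul_sum (fun w => ?_) fun j => integrable_mul_mul (hP j i) (hP j l) (hP j m)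
  simpa [hil.symm, hlm.symm, hmi] using mul_mul_eq_C1_mul_sum_sub hd hk h (X w) i l m

end integrals

end MomentFusion

theorem mainTheorem4 {d k n : ℕ} (hd : 3 ≤ d) (hk : 1 ≤ k) (hkd : k < d)
    {Ω : Type*} [MeasurableSpace Ω] (μ : Measure Ω) [IsProbabilityMeasure μ]
    (X : Ω → Fin d → ℝ)
    (P : Fin n → MomentFusion.Grassmannian k d) (ω : Fin n → ℝ) :
    -- (i)
    (MomentFusion.IsCubature hkd.le 2 1 P ω → (∀ a, MemLp (fun w => X w a) 1 μ) →
      ∀ i : Fin d,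
        ∫ w, X w i ∂μ
          = MomentFusion.A1 k d * ∑ j, ω j * ∫ w, ((P j).1 *ᵥ X w) i ∂μ) ∧
    -- (ii)
    (MomentFusion.IsCubature hkd.le 2 2 P ω → (∀ a, MemLp (fun w => X w a) 2 μ) →
      (∀ i : Fin d,
        ∫ w, X w i ∂μ
          = MomentFusion.A1 k d * ∑ j, ω j * ∫ w, ((P j).1 *ᵥ X w) i ∂μ) ∧
      (∀ i : Fin d,
        ∫ w, X w i ^ 2 ∂μ
          = MomentFusion.A2 k d * (∑ j, ω j * ∫ w, ((P j).1 *ᵥ X w) i ^ 2 ∂μ)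
            - MomentFusion.B2 k d * ∑ j, ∑ m, ω j * ∫ w, ((P j).1 *ᵥ X w) m ^ 2 ∂μ) ∧
      (∀ i l : Fin d, i ≠ l →
        ∫ w, X w i * X w l ∂μ
          = MomentFusion.A2 k d *
              ∑ j, ω j * ∫ w, ((P j).1 *ᵥ X w) i * ((P j).1 *ᵥ X w) l ∂μ)) ∧
    -- (iii)
    (MomentFusion.IsCubature hkd.le 2 3 P ω → (∀ a, MemLp (fun w => X w a) 3 μ) →
      (∀ i : Fin d,
        ∫ w, X w i ∂μ
          = MomentFusion.A1 k d * ∑ j, ω j * ∫ w, ((P j).1 *ᵥ X w) i ∂μ) ∧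
      (∀ i : Fin d,
        ∫ w, X w i ^ 2 ∂μ
          = MomentFusion.A2 k d * (∑ j, ω j * ∫ w, ((P j).1 *ᵥ X w) i ^ 2 ∂μ)
            - MomentFusion.B2 k d * ∑ j, ∑ m, ω j * ∫ w, ((P j).1 *ᵥ X w) m ^ 2 ∂μ) ∧
      (∀ i l : Fin d, i ≠ l →
        ∫ w, X w i * X w l ∂μ
          = MomentFusion.A2 k d *
              ∑ j, ω j * ∫ w, ((P j).1 *ᵥ X w) i * ((P j).1 *ᵥ X w) l ∂μ) ∧
      (∀ i : Fin d,
        ∫ w, X w i ^ 3 ∂μ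
          = MomentFusion.C1 k d * (∑ j, ω j * ∫ w, ((P j).1 *ᵥ X w) i ^ 3 ∂μ)
            - MomentFusion.C2 k d * ∑ j, ∑ m,
                ω j * ∫ w, ((P j).1 *ᵥ X w) i * ((P j).1 *ᵥ X w) m ^ 2 ∂μ) ∧
      (∀ i h : Fin d, i ≠ h →
        ∫ w, X w i ^ 2 * X w h ∂μ
          = MomentFusion.C1 k d *
              (∑ j, ω j * ∫ w, ((P j).1 *ᵥ X w) i ^ 2 * ((P j).1 *ᵥ X w) h ∂μ)
            - 1 / 3 * MomentFusion.C2 k d * ∑ j, ∑ m,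
                ω j * ∫ w, ((P j).1 *ᵥ X w) h * ((P j).1 *ᵥ X w) m ^ 2 ∂μ) ∧
      (∀ i h l : Fin d, i ≠ h → h ≠ l → l ≠ i →
        ∫ w, X w i * X w h * X w l ∂μ
          = MomentFusion.C1 k d *
              ∑ j, ω j *
                ∫ w, ((P j).1 *ᵥ X w) i * ((P j).1 *ᵥ X w) h * ((P j).1 *ᵥ X w) l ∂μ)) := by
  -- On a probability space a finite higher moment bounds the lower ones.
  have hle : ∀ {p q : ENNReal}, p ≤ q → (∀ a, MemLp (fun w => X w a) q μ) →
      ∀ a, MemLp (fun w => X w a) p μ := fun hpq hX a => (hX a).mono_exponent hpq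
  refine ⟨fun hc hX i => MomentFusion.integral_coord hd hk hc hX i, fun hc hX => ?_,
    fun hc hX => ?_⟩
  · exact ⟨MomentFusion.integral_coord hd hk (hc.mono one_le_two) (hle (by norm_num) hX),
      MomentFusion.integral_coord_sq hd hk hc hX,
      fun _ _ => MomentFusion.integral_coord_mul hd hk hc hX⟩
  · have hX2 := hle (p := 2) (by norm_num) hX
    have hc2 := hc.mono (by norm_num : 2 ≤ 3)
    exact ⟨MomentFusion.integral_coord hd hk (hc.mono (by norm_num)) (hle (by norm_num) hX),
      MomentFusion.integral_coord_sq hd hk hc2 hX2,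
      fun _ _ => MomentFusion.integral_coord_mul hd hk hc2 hX2,
      MomentFusion.integral_coord_cube hd hk hc hX,
      fun _ _ => MomentFusion.integral_coord_sq_mul hd hk hc hX,
      fun _ _ _ => MomentFusion.integral_coord_mul_mul hd hk hc hX⟩
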